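/- Let $G$ be a finite simple connected graph with $n$ vertices and $m$ edges. For vertices $i,j$ of a connected graph let $d_i$ be the degree of $i$ and let $r_{ij}$ be the resistance distance, that is, the effective resistance between $i$ and $j$ in the electrical network obtained by replacing every edge with a unit resistor. The additive and the multiplicative degree-Kirchhoff index of a connected graph $H$ are $$\bar{\mathcal K}(H)=\frac12\sum_{i,j\in V(H)}(d_i+d_j)\,r_{ij},\qquad \hat{\mathcal K}(H)=\frac12\sum_{i,j\in V(H)}d_id_j\,r_{ij}.$$ For a positive integer $q$, the $q$-triangulation graph $R_q(G)$ is obtained from $G$ by adding, for each edge $uv$ of $G$, $q$ new vertices $x_1,\dots,x_q$, each joined exactly to $u$ and $v$ (the edge $uv$ is kept). Put $R_{q,0}(G)=G$ and $R_{q,k}(G)=R_q(R_{q,k-1}(G))$ for $k\ge 1$. Then for every integer $q\ge 1$ and every integer $k\ge 0$, $$\begin{aligned} \bar{\mathcal K}(R_{q,k}(G))={}&\Big(\tfrac{2(2q+1)}{q+2}\Big)^k\bar{\mathcal K}(G)\\ &+\Big[\Big(\tfrac{2(2q+1)^2}{q+2}\Big)^k-\Big(\tfrac{2(2q+1)}{q+2}\Big)^k\Big]\Big(\frac{\hat{\mathcal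 K}(G)}{2}-\frac{2(q+2)m^2+(2q+1)mn-m(q-1)}{3(2q+1)}\Big)\\ &+\Big[(2q+1)^{2k}-\Big(\tfrac{2(2q+1)}{q+2}\Big)^k\Big]\frac{m^2(2q+3)(6q+11)}{4(2q+1)(2q+5)}\\ &+\Big[\Big(\tfrac{2(2q+1)}{q+2}\Big)^k-(2q+1)^k\Big]\Big(\frac{m}{2(2q+1)}+\frac{(q+2)m(m-2n+1)}{3(2q+1)}\Big)\\ &-\Big[\Big(\tfrac{2(2q+1)}{q+2}\Big)^k-1\Big]\frac{(m-2n)(m-2n+2)}{12}. \end{aligned}$$ -/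

import Mathlib

namespace SimpleGraph

universe u

open Classical in
/-- In the electrical network that has a unit resistor on every edge of `G`, the potential `v`
drives a current of strength `1` that enters the network at `i` and leaves it at `j`: by Ohm's law
the current from `x` to `y` along an edge is `v x - v y`, and by Kirchhoff's current law the net
current out of `x` is the external current supplied at `x`. -/
def IsUnitCurrentPotential {V : Type u} [Fintype V] (G : SimpleGraph V) (i j : V)
    (v : V → ℝ) : Prop :=
  ∀ x : V, ∑ y ∈ G.neighborFinset x, (v x - v y) =
    (if x = i then 1 else 0) - (if x = j then 1 else 0)

open Classical in
/-- The resistance distance between `i` and `j`: the potential difference between `i` and `j` when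
a unit current flows from `i` to `j`. In a connected graph a potential as required exists, and
the potential difference does not depend on the potential chosen (see the two facts below).
The value is `0` by convention if there is no such potential. -/
noncomputable def resistanceDistance {V : Type u} [Fintype V] (G : SimpleGraph V) (i j : V) : ℝ :=
  if h : ∃ v, G.IsUnitCurrentPotential i j v then h.choose i - h.choose j else 0

open Classical in
/-- Both laws together say that the Laplacian maps `v` to the external current. -/
theorem isUnitCurrentPotential_iff {V : Type u} [Fintype V] (G : SimpleGraph V) (i j : V)
    (v : V → ℝ) : G.IsUnitCurrentPotential i j v ↔
      Matrix.mulVec (G.lapMatrix ℝ) v = Pi.single i 1 - Pi.single j 1 := by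
  rw [funext_iff]
  refine forall_congr' fun x => ?_
  rw [lapMatrix_mulVec_apply, Finset.sum_sub_distrib]
  simp [Pi.single_apply]

/-- The resistance distance can be computed from any potential for a unit current. -/
theorem resistanceDistance_eq {V : Type u} [Fintype V] (G : SimpleGraph V) (i j : V)
    (v : V → ℝ) (hv : G.IsUnitCurrentPotential i j v) :
    G.resistanceDistance i j = v i - v j := by
  classical
  have h : ∃ v, G.IsUnitCurrentPotential i j v := ⟨v, hv⟩
  rw [resistanceDistance, dif_pos h]
  have hw := h.choose_spec
  generalize h.choose = w at hw
  rw [isUnitCurrentPotential_iff] at hv hw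
  have e : w ⬝ᵥ (Matrix.mulVec (G.lapMatrix ℝ) v) = (Matrix.mulVec (G.lapMatrix ℝ) w) ⬝ᵥ v := by
    rw [Matrix.dotProduct_mulVec, ← Matrix.mulVec_transpose, (G.isSymm_lapMatrix (R := ℝ)).eq]
  rw [hv, hw] at e
  simpa [dotProduct_sub, sub_dotProduct] using e

/-- In a connected graph a potential for a unit current from `i` to `j` exists. -/
theorem exists_isUnitCurrentPotential {V : Type u} [Fintype V] (G : SimpleGraph V)
    (hG : G.Connected) (i j : V) : ∃ v, G.IsUnitCurrentPotential i j v := by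
  classical
  simp only [isUnitCurrentPotential_iff]
  have sumL : ∀ v : V → ℝ, ∑ x, Matrix.mulVec (G.lapMatrix ℝ) v x = 0 := by
    intro v
    have e : (fun _ => (1 : ℝ)) ⬝ᵥ (Matrix.mulVec (G.lapMatrix ℝ) v)
        = (Matrix.mulVec (G.lapMatrix ℝ) (fun _ => (1 : ℝ))) ⬝ᵥ v := by
      rw [Matrix.dotProduct_mulVec, ← Matrix.mulVec_transpose,
        (G.isSymm_lapMatrix (R := ℝ)).eq]
    rw [lapMatrix_mulVec_const_eq_zero] at e
    simpa [dotProduct] using e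
  have hcard : (Fintype.card V : ℝ) ≠ 0 := by
    have : Nonempty V := ⟨i⟩
    exact_mod_cast Fintype.card_ne_zero
  let T : (V → ℝ) →ₗ[ℝ] (V → ℝ) :=
    { toFun := fun v => Matrix.mulVec (G.lapMatrix ℝ) v + fun _ => ∑ x, v x
      map_add' := by
        intro a b
        ext x
        simp only [Matrix.mulVec_add, Pi.add_apply, Finset.sum_add_distrib]
        ring
      map_smul' := by
        intro c a
        ext x
        simp only [Matrix.mulVec_smul, Pi.add_apply, Pi.smul_apply, smul_eq_mul,
          Finset.mul_sum, RingHom.id_apply, mul_add] }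
  have hT : ∀ v x, T v x = Matrix.mulVec (G.lapMatrix ℝ) v x + ∑ y, v y := fun _ _ => rfl
  have sumT : ∀ v, ∑ x, T v x = 0 → ∑ y, v y = 0 := by
    intro v h
    simp only [hT, Finset.sum_add_distrib, sumL, Finset.sum_const, Finset.card_univ,
      nsmul_eq_mul, zero_add] at h
    exact (mul_eq_zero.mp h).resolve_left hcard
  have inj : Function.Injective T := by
    rw [injective_iff_map_eq_zero]
    intro v hv
    have s0 : ∑ y, v y = 0 := sumT v (by simp [hv])
    have l0 : Matrix.mulVec (G.lapMatrix ℝ) v = 0 := by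
      ext x
      have := hT v x
      rw [hv, s0] at this
      simpa using this.symm
    have hc := (G.lapMatrix_mulVec_eq_zero_iff_forall_reachable).mp l0
    ext x
    have hx : ∀ y, v y = v x := fun y => hc y x (hG.preconnected y x)
    simp only [hx, Finset.sum_const, Finset.card_univ, nsmul_eq_mul] at s0
    exact (mul_eq_zero.mp s0).resolve_left hcard
  obtain ⟨v, hv⟩ := LinearMap.injective_iff_surjective.mp inj (Pi.single i 1 - Pi.single j 1)
  have s0 : ∑ y, v y = 0 := sumT v (by simp [hv])
  refine ⟨v, ?_⟩
  ext x
  have := hT v x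
  rw [hv, s0, add_zero] at this
  exact this.symm

open Classical in
/-- The additive degree-Kirchhoff index: half the sum of `(d_i + d_j) r_{ij}` over all ordered
pairs of vertices, which is the sum over all unordered pairs. -/
noncomputable def additiveDegreeKirchhoff {V : Type u} [Fintype V] (G : SimpleGraph V) : ℝ :=
  (1 / 2) * ∑ i : V, ∑ j : V, ((G.degree i : ℝ) + (G.degree j : ℝ)) * G.resistanceDistance i j

open Classical in
/-- The multiplicative degree-Kirchhoff index: half the sum of `d_i d_j r_{ij}` over all ordered
pairs of vertices, which is the sum over all unordered pairs. -/
noncomputable def multiplicativeDegreeKirchhoff {V : Type u} [Fintype V] (G : SimpleGraph V) : ℝ :=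
  (1 / 2) * ∑ i : V, ∑ j : V, ((G.degree i : ℝ) * (G.degree j : ℝ)) * G.resistanceDistance i j

/-- The `q`-triangulation graph of `G`: every edge `e` of `G` is kept, and for each `e` there are
`q` new vertices `(e, 0), …, (e, q - 1)`, each of them adjacent exactly to the two ends of `e`. -/
def qTriangulation {V : Type u} (q : ℕ) (G : SimpleGraph V) :
    SimpleGraph (V ⊕ (G.edgeSet × Fin q)) where
  Adj
    | Sum.inl u, Sum.inl v => G.Adj u v
    | Sum.inl u, Sum.inr (e, _) => u ∈ (e : Sym2 V)
    | Sum.inr (e, _), Sum.inl v => v ∈ (e : Sym2 V)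
    | Sum.inr _, Sum.inr _ => False
  symm := ⟨by
    rintro (u | ⟨e, a⟩) (v | ⟨f, b⟩) h
    · exact SimpleGraph.Adj.symm (G := G) h
    · exact h
    · exact h
    · exact h⟩
  loopless := ⟨by
    rintro (u | ⟨e, a⟩) h
    · exact G.loopless.irrefl u h
    · exact h⟩

end SimpleGraph

universe u

/-- A finite simple graph bundled with its vertex type. -/
structure FinGraph : Type (u + 1) where
  V : Type u
  fintypeV : Fintype V
  graph : SimpleGraph V

attribute [instance] FinGraph.fintypeV

open Classical in
/-- The `q`-triangulation of a bundled finite graph. -/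
noncomputable def FinGraph.qTriangulation (q : ℕ) (H : FinGraph.{u}) : FinGraph.{u} where
  V := H.V ⊕ (H.graph.edgeSet × Fin q)
  fintypeV := inferInstance
  graph := H.graph.qTriangulation q

/-- The iterated `q`-triangulation graph of `G`: `G` itself for `k = 0`, and the
`q`-triangulation of the previous graph in each further step. -/
noncomputable def SimpleGraph.iteratedQTriangulation {V : Type u} [hV : Fintype V]
    (G : SimpleGraph V) (q : ℕ) : ℕ → FinGraph.{u}
  | 0 => ⟨V, hV, G⟩
  | k + 1 => (SimpleGraph.iteratedQTriangulation G q k).qTriangulation q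

namespace SimpleGraph

/-! Replace resistances by a Green kernel: a symmetric `g` with Laplacian `δ_i - κ` in each column.
Then `r_ij = g i i + g j j - 2 g i j`, so both indices become linear in `g`, and any choice of
kernel serves.

Such a kernel passes explicitly to the `q`-triangulation. A new vertex without external current
takes the mean of the potentials at its two neighbours, so the `q` paths over an edge raise its
conductance from `1` to `(q + 2) / 2`. Hence `g` is scaled by `2 / (q + 2)`, extended by edge means
in both variables, and corrected by `1 / 2` on the diagonal at new vertices
(`IsGreenKernel.qTriangulation`).

Weighted sums of the new kernel pull back to `G`; the diagonal also needs Foster's theorem. The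
degree weight pulls back to `2q + 1` times the old one, the constant weight to `1 + (q/2) deg`. This
gives a triangular linear recurrence for the two indices, solved by induction on `k`. -/

open scoped Classical in
/-- The mean of `f` over the two ends of an edge `e`. -/
noncomputable def edgeMean {V : Type u} [Fintype V] (e : Sym2 V) (f : V → ℝ) : ℝ :=
  (∑ u, if u ∈ e then f u else 0) / 2

/-! ### Means over the ends of an edge and their sums over all edges. -/

section EdgeMean

open scoped Classical

variable {V : Type u} [Fintype V]

theorem edgeMean_mk {x y : V} (h : x ≠ y) (f : V → ℝ) :
    edgeMean s(x, y) f = (f x + f y) / 2 := by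
  unfold edgeMean
  congr 1
  rw [← Finset.sum_filter, show Finset.univ.filter (· ∈ s(x, y)) = {x, y} by ext; simp,
    Finset.sum_pair h]

theorem edgeMean_const {G : SimpleGraph V} (e : G.edgeSet) (c : ℝ) :
    edgeMean (e : Sym2 V) (fun _ => c) = c := by
  obtain ⟨e, he⟩ := e
  induction e with
  | _ x y =>
    rw [edgeMean_mk (G.ne_of_adj he)]
    ring

theorem edgeMean_add (e : Sym2 V) (f g : V → ℝ) :
    edgeMean e (fun u => f u + g u) = edgeMean e f + edgeMean e g := by
  simp only [edgeMean, ← add_div, ← Finset.sum_add_distrib]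
  congr! 2
  split_ifs <;> simp

theorem edgeMean_mul (e : Sym2 V) (c : ℝ) (f : V → ℝ) :
    edgeMean e (fun u => c * f u) = c * edgeMean e f := by
  simp only [edgeMean, ← mul_div_assoc, Finset.mul_sum, mul_ite, mul_zero]

theorem edgeMean_sum {ι : Type*} (s : Finset ι) (e : Sym2 V) (f : ι → V → ℝ) :
    edgeMean e (fun u => ∑ i ∈ s, f i u) = ∑ i ∈ s, edgeMean e (f i) := by
  induction s using Finset.induction_on with
  | empty => simp [edgeMean]
  | insert a s ha ih => simp only [Finset.sum_insert ha, edgeMean_add, ih]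

theorem edgeMean_sub (e : Sym2 V) (f g : V → ℝ) :
    edgeMean e (fun u => f u - g u) = edgeMean e f - edgeMean e g := by
  have := edgeMean_add e (fun u => f u - g u) g
  simp only [sub_add_cancel] at this
  rw [this]
  ring

theorem edgeMean_single (e : Sym2 V) (x : V) :
    edgeMean e (fun u => if x = u then 1 else 0) = if x ∈ e then 1 / 2 else 0 := by
  unfold edgeMean
  rw [Finset.sum_eq_single x]
  · split_ifs <;> simp_all
  · intro b _ hb
    simp [hb.symm]
  · simp

theorem edgeMean_comm (e f : Sym2 V) (g : V → V → ℝ) :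
    edgeMean e (fun u => edgeMean f (g u)) = edgeMean f (fun v => edgeMean e (fun u => g u v)) := by
  have h : ∀ u, (if u ∈ e then (∑ v, if v ∈ f then g u v else 0) / 2 else 0) =
      ∑ v, (if u ∈ e then if v ∈ f then g u v else 0 else 0) / 2 := by
    intro u
    split_ifs <;> simp [Finset.sum_div]
  have h' : ∀ v, (if v ∈ f then (∑ u, if u ∈ e then g u v else 0) / 2 else 0) =
      ∑ u, (if u ∈ e then if v ∈ f then g u v else 0 else 0) / 2 := by
    intro v
    split_ifs <;> simp [Finset.sum_div]
  simp only [edgeMean, h, h']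
  rw [Finset.sum_comm]

theorem sum_edgeSet_ite_mem (G : SimpleGraph V) (x : V) (F : Sym2 V → ℝ) :
    ∑ e : G.edgeSet, (if x ∈ (e : Sym2 V) then F e else 0) =
      ∑ y ∈ G.neighborFinset x, F s(x, y) := by
  rw [← Finset.sum_filter]
  symm
  refine Finset.sum_bij (fun y hy => ⟨s(x, y), by simpa using hy⟩) ?_ ?_ ?_ ?_
  · intro y hy
    simp
  · intro a ha b hb h
    simpa using Sym2.congr_right.1 (congrArg Subtype.val h)
  · rintro ⟨e, he⟩ hx
    obtain ⟨y, rfl⟩ : ∃ y, e = s(x, y) := by simpa [Sym2.mem_iff_exists] using hx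
    exact ⟨y, by simpa using he, rfl⟩
  · intros
    rfl

theorem sum_edgeMean (G : SimpleGraph V) (f : V → ℝ) :
    ∑ e : G.edgeSet, edgeMean (e : Sym2 V) f = (∑ x, (G.degree x : ℝ) * f x) / 2 := by
  simp only [edgeMean]
  rw [← Finset.sum_div, Finset.sum_comm]
  congr 2 with x
  rw [sum_edgeSet_ite_mem G x (fun _ => f x)]
  simp

theorem card_edgeSet_eq (G : SimpleGraph V) :
    (Fintype.card G.edgeSet : ℝ) = (∑ x, (G.degree x : ℝ)) / 2 := by
  have := sum_edgeMean G (fun _ => 1)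
  simpa [edgeMean_const] using this

theorem sum_edgeMean_of_mem (G : SimpleGraph V) (x : V) (f : V → ℝ) :
    ∑ e : G.edgeSet, (if x ∈ (e : Sym2 V) then edgeMean (e : Sym2 V) f else 0) =
      (G.degree x * f x + ∑ y ∈ G.neighborFinset x, f y) / 2 := by
  rw [sum_edgeSet_ite_mem G x (fun e => edgeMean e f),
    Finset.sum_congr rfl fun y hy => edgeMean_mk (G.ne_of_adj ((G.mem_neighborFinset x y).1 hy)) f,
    ← Finset.sum_div, Finset.sum_add_distrib]
  simp

/-- Prepares the diagonal of the new kernel: at a new vertex over `e` its main term is this double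
mean. -/
theorem sum_edgeMean_edgeMean (G : SimpleGraph V) (g : V → V → ℝ) :
    ∑ e : G.edgeSet, edgeMean (e : Sym2 V) (fun u => edgeMean (e : Sym2 V) (g u)) =
      (∑ x, (G.degree x * g x x + ∑ y ∈ G.neighborFinset x, g x y)) / 4 := by
  have h : ∀ e : G.edgeSet, edgeMean (e : Sym2 V) (fun u => edgeMean (e : Sym2 V) (g u)) =
      (∑ x, if x ∈ (e : Sym2 V) then edgeMean (e : Sym2 V) (g x) else 0) / 2 := fun e => rfl
  simp only [h]
  rw [← Finset.sum_div, Finset.sum_comm]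
  simp only [sum_edgeMean_of_mem]
  rw [← Finset.sum_div]
  ring

end EdgeMean

/-! ### Green kernels, and the two indices as linear functions of them. -/

section Green

open scoped Classical

variable {V : Type u} [Fintype V]

/-- A symmetric kernel `g` whose columns are potentials for a unit current that enters at one
vertex and leaves the network distributed according to `κ`. -/
structure IsGreenKernel (G : SimpleGraph V) (g : V → V → ℝ) (κ : V → ℝ) : Prop where
  symm : ∀ i j, g i j = g j i
  laplacian : ∀ x i, ∑ y ∈ G.neighborFinset x, (g x i - g y i) = (if x = i then 1 else 0) - κ x
  sum_eq_one : ∑ x, κ x = 1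

/-- In the difference of columns `i` and `j` the sink `κ` cancels, leaving a unit current potential.
-/
theorem IsGreenKernel.resistanceDistance_eq {G : SimpleGraph V} {g : V → V → ℝ} {κ : V → ℝ}
    (h : G.IsGreenKernel g κ) (i j : V) :
    G.resistanceDistance i j = g i i + g j j - 2 * g i j := by
  rw [G.resistanceDistance_eq i j (fun x => g x i - g x j)]
  · rw [h.symm j i]
    ring
  · intro x
    have : ∀ y, g x i - g x j - (g y i - g y j) = (g x i - g y i) - (g x j - g y j) := by
      intro y
      ring
    simp only [this, Finset.sum_sub_distrib (fun y => g x i - g y i), h.laplacian]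
    ring

/-- Ground the network at a vertex `o`: all current leaves there and potentials vanish there.
Symmetry is reciprocity, from the symmetry of the Laplacian. -/
theorem Connected.exists_isGreenKernel {G : SimpleGraph V} (hG : G.Connected) :
    ∃ g κ, G.IsGreenKernel g κ := by
  obtain ⟨o⟩ := hG.nonempty
  choose v hv using fun i => G.exists_isUnitCurrentPotential hG i o
  refine ⟨fun x i => v i x - v i o, fun x => if x = o then 1 else 0, ?_, ?_, ?_⟩
  · intro i j
    have hi := (G.isUnitCurrentPotential_iff i o _).1 (hv i)
    have hj := (G.isUnitCurrentPotential_iff j o _).1 (hv j)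
    have e : v i ⬝ᵥ (Matrix.mulVec (G.lapMatrix ℝ) (v j)) =
        (Matrix.mulVec (G.lapMatrix ℝ) (v i)) ⬝ᵥ v j := by
      rw [Matrix.dotProduct_mulVec, ← Matrix.mulVec_transpose, (G.isSymm_lapMatrix (R := ℝ)).eq]
    rw [hi, hj] at e
    simpa [dotProduct_sub, sub_dotProduct] using e.symm
  · intro x i
    simpa using hv i x
  · simp

/-- Foster's theorem, summed over ordered pairs of adjacent vertices. -/
theorem IsGreenKernel.foster {G : SimpleGraph V} {g : V → V → ℝ} {κ : V → ℝ}
    (h : G.IsGreenKernel g κ) :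
    ∑ x, ∑ y ∈ G.neighborFinset x, g x y = ∑ x, (G.degree x : ℝ) * g x x - (Fintype.card V - 1) := by
  -- This is the trace of the Laplacian applied to `g`, that is, of `δ - κ`.
  have key : ∑ x, ∑ y ∈ G.neighborFinset x, (g x x - g y x) = (Fintype.card V : ℝ) - 1 := by
    simp only [h.laplacian, if_true, Finset.sum_sub_distrib, h.sum_eq_one]
    simp
  rw [← key]
  simp only [Finset.sum_sub_distrib, Finset.sum_const, card_neighborFinset_eq_degree, nsmul_eq_mul,
    h.symm _ _, sub_sub_cancel]

theorem IsGreenKernel.additiveDegreeKirchhoff_eq {G : SimpleGraph V} {g : V → V → ℝ} {κ : V → ℝ}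
    (h : G.IsGreenKernel g κ) :
    G.additiveDegreeKirchhoff = Fintype.card V * ∑ x, (G.degree x : ℝ) * g x x
      + (∑ x, (G.degree x : ℝ)) * ∑ x, g x x - 2 * ∑ x, G.degree x * ∑ y, g x y := by
  -- The second bracket is the first with `i` and `j` exchanged, so the two have equal double sums.
  have e : ∀ i j, ((G.degree i : ℝ) + G.degree j) * G.resistanceDistance i j =
      (G.degree i * g i i + G.degree i * g j j - 2 * (G.degree i * g i j)) +
      (G.degree j * g j j + g i i * G.degree j - 2 * (G.degree j * g j i)) := by
    intro i j
    rw [h.resistanceDistance_eq, h.symm j i]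
    ring
  unfold additiveDegreeKirchhoff
  simp only [e, Finset.sum_add_distrib, Finset.sum_sub_distrib]
  rw [Finset.sum_comm (f := fun i j => 2 * ((G.degree j : ℝ) * g j i))]
  simp only [Finset.sum_const, Finset.card_univ, nsmul_eq_mul]
  simp only [← Finset.mul_sum, ← Finset.sum_mul]
  ring

theorem IsGreenKernel.multiplicativeDegreeKirchhoff_eq {G : SimpleGraph V} {g : V → V → ℝ}
    {κ : V → ℝ} (h : G.IsGreenKernel g κ) :
    G.multiplicativeDegreeKirchhoff = (∑ x, (G.degree x : ℝ)) * ∑ x, (G.degree x : ℝ) * g x x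
      - ∑ x, G.degree x * ∑ y, G.degree y * g x y := by
  have e : ∀ i j, ((G.degree i : ℝ) * G.degree j) * G.resistanceDistance i j =
      (G.degree i * g i i) * G.degree j + G.degree i * (G.degree j * g j j)
        - 2 * (G.degree i * (G.degree j * g i j)) := by
    intro i j
    rw [h.resistanceDistance_eq]
    ring
  unfold multiplicativeDegreeKirchhoff
  simp only [e, Finset.sum_add_distrib, Finset.sum_sub_distrib]
  simp only [← Finset.mul_sum, ← Finset.sum_mul]
  ring

end Green

/-! ### Adjacency in the `q`-triangulation. -/

section QTriangulationAdj

variable {V : Type u}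

theorem qTriangulation_adj_inl_inl (q : ℕ) (G : SimpleGraph V) (x y : V) :
    (G.qTriangulation q).Adj (Sum.inl x) (Sum.inl y) ↔ G.Adj x y := Iff.rfl

theorem qTriangulation_adj_inl_inr (q : ℕ) (G : SimpleGraph V) (x : V) (p : G.edgeSet × Fin q) :
    (G.qTriangulation q).Adj (Sum.inl x) (Sum.inr p) ↔ x ∈ (p.1 : Sym2 V) := Iff.rfl

theorem qTriangulation_adj_inr_inl (q : ℕ) (G : SimpleGraph V) (x : V) (p : G.edgeSet × Fin q) :
    (G.qTriangulation q).Adj (Sum.inr p) (Sum.inl x) ↔ x ∈ (p.1 : Sym2 V) := Iff.rfl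

theorem qTriangulation_not_adj_inr_inr (q : ℕ) (G : SimpleGraph V) (p r : G.edgeSet × Fin q) :
    ¬ (G.qTriangulation q).Adj (Sum.inr p) (Sum.inr r) := not_false

end QTriangulationAdj

/-! ### Harmonic extension and the Green kernel of the `q`-triangulation. -/

section QTriangulation

open scoped Classical

variable {V : Type u} [Fintype V]

theorem sum_neighborFinset_qTriangulation_inl (q : ℕ) (G : SimpleGraph V) (x : V)
    (F : V ⊕ (G.edgeSet × Fin q) → ℝ) :
    ∑ y ∈ (G.qTriangulation q).neighborFinset (Sum.inl x), F y =
      ∑ y ∈ G.neighborFinset x, F (Sum.inl y) +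
        ∑ e : G.edgeSet, if x ∈ (e : Sym2 V) then ∑ a, F (Sum.inr (e, a)) else 0 := by
  simp only [neighborFinset_eq_filter, Finset.sum_filter, Fintype.sum_sum_type,
    Fintype.sum_prod_type, qTriangulation_adj_inl_inl, qTriangulation_adj_inl_inr]
  congr 1
  refine Finset.sum_congr rfl fun e _ => ?_
  split_ifs <;> simp

theorem sum_neighborFinset_qTriangulation_inr (q : ℕ) (G : SimpleGraph V) (e : G.edgeSet)
    (a : Fin q) (F : V ⊕ (G.edgeSet × Fin q) → ℝ) :
    ∑ y ∈ (G.qTriangulation q).neighborFinset (Sum.inr (e, a)), F y =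
      2 * edgeMean (e : Sym2 V) (fun u => F (Sum.inl u)) := by
  simp only [neighborFinset_eq_filter, Finset.sum_filter, Fintype.sum_sum_type, edgeMean,
    qTriangulation_adj_inr_inl, qTriangulation_not_adj_inr_inr]
  simp [mul_div_cancel₀]

theorem degree_qTriangulation_inl (q : ℕ) (G : SimpleGraph V) (x : V) :
    ((G.qTriangulation q).degree (Sum.inl x) : ℝ) = (1 + q) * G.degree x := by
  have := sum_neighborFinset_qTriangulation_inl q G x (fun _ => 1)
  have h := sum_edgeSet_ite_mem G x (fun _ => q)
  simp only [Finset.sum_const, card_neighborFinset_eq_degree, nsmul_eq_mul, mul_one,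
    Finset.card_univ, Fintype.card_fin] at this h
  rw [this, h]
  ring

theorem degree_qTriangulation_inr (q : ℕ) (G : SimpleGraph V) (p : G.edgeSet × Fin q) :
    ((G.qTriangulation q).degree (Sum.inr p) : ℝ) = 2 := by
  have := sum_neighborFinset_qTriangulation_inr q G p.1 p.2 (fun _ => 1)
  simpa [edgeMean_const] using this

/-- The extension of a potential on `G` to the `q`-triangulation when no external current enters
at the new vertices. -/
noncomputable def harmonicExtension (q : ℕ) (G : SimpleGraph V) (f : V → ℝ) :
    V ⊕ (G.edgeSet × Fin q) → ℝ
  | Sum.inl x => f x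
  | Sum.inr p => edgeMean (p.1 : Sym2 V) f

theorem harmonicExtension_sub (q : ℕ) (G : SimpleGraph V) (f g : V → ℝ)
    (i : V ⊕ (G.edgeSet × Fin q)) :
    harmonicExtension q G (fun u => f u - g u) i =
      harmonicExtension q G f i - harmonicExtension q G g i := by
  cases i
  · rfl
  · exact edgeMean_sub _ _ _

theorem harmonicExtension_mul (q : ℕ) (G : SimpleGraph V) (c : ℝ) (f : V → ℝ)
    (i : V ⊕ (G.edgeSet × Fin q)) :
    harmonicExtension q G (fun u => c * f u) i = c * harmonicExtension q G f i := by
  cases i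
  · rfl
  · exact edgeMean_mul _ _ _

theorem harmonicExtension_const (q : ℕ) (G : SimpleGraph V) (c : ℝ)
    (i : V ⊕ (G.edgeSet × Fin q)) : harmonicExtension q G (fun _ => c) i = c := by
  cases i
  · rfl
  · exact edgeMean_const _ _

theorem harmonicExtension_sum {ι : Type*} (s : Finset ι) (q : ℕ) (G : SimpleGraph V)
    (f : ι → V → ℝ) (i : V ⊕ (G.edgeSet × Fin q)) :
    harmonicExtension q G (fun u => ∑ k ∈ s, f k u) i =
      ∑ k ∈ s, harmonicExtension q G (f k) i := by
  cases i
  · rfl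
  · exact edgeMean_sum _ _ _

theorem harmonicExtension_comm (q : ℕ) (G : SimpleGraph V) (g : V → V → ℝ)
    (i j : V ⊕ (G.edgeSet × Fin q)) :
    harmonicExtension q G (fun u => harmonicExtension q G (g u) j) i =
      harmonicExtension q G (fun v => harmonicExtension q G (fun u => g u v) i) j := by
  cases i <;> cases j
  · rfl
  · rfl
  · rfl
  · exact edgeMean_comm _ _ _

/-- Along an edge `xy`, each of the `q` new paths carries `f x - (f x + f y) / 2`, half the current
of the edge itself. -/
theorem laplacian_harmonicExtension_inl (q : ℕ) (G : SimpleGraph V) (f : V → ℝ) (x : V) :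
    ∑ y ∈ (G.qTriangulation q).neighborFinset (Sum.inl x),
      (harmonicExtension q G f (Sum.inl x) - harmonicExtension q G f y) =
      (q + 2) / 2 * ∑ y ∈ G.neighborFinset x, (f x - f y) := by
  rw [sum_neighborFinset_qTriangulation_inl]
  simp only [harmonicExtension, Finset.sum_const, Finset.card_univ, Fintype.card_fin, nsmul_eq_mul]
  have h1 := sum_edgeSet_ite_mem G x (fun _ => q * f x)
  have h2 := sum_edgeMean_of_mem G x f
  have h3 : ∀ e : G.edgeSet, (if x ∈ (e : Sym2 V) then (q : ℝ) * (f x - edgeMean (e : Sym2 V) f)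
      else 0) = (if x ∈ (e : Sym2 V) then (q : ℝ) * f x else 0) -
        q * (if x ∈ (e : Sym2 V) then edgeMean (e : Sym2 V) f else 0) := by
    intro e
    split_ifs <;> ring
  simp only [h3, Finset.sum_sub_distrib, ← Finset.mul_sum, h1, h2]
  simp only [Finset.sum_const, card_neighborFinset_eq_degree, nsmul_eq_mul]
  ring

theorem laplacian_harmonicExtension_inr (q : ℕ) (G : SimpleGraph V) (f : V → ℝ)
    (p : G.edgeSet × Fin q) :
    ∑ y ∈ (G.qTriangulation q).neighborFinset (Sum.inr p),
      (harmonicExtension q G f (Sum.inr p) - harmonicExtension q G f y) = 0 := by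
  rw [sum_neighborFinset_qTriangulation_inr]
  simp only [harmonicExtension, edgeMean_sub, edgeMean_const, sub_self, mul_zero]

/-- The Green kernel of the `q`-triangulation that is built from one of `G`. -/
noncomputable def qTriangulationKernel (q : ℕ) (G : SimpleGraph V) (g : V → V → ℝ)
    (i j : V ⊕ (G.edgeSet × Fin q)) : ℝ :=
  2 / (q + 2) * harmonicExtension q G (fun u => harmonicExtension q G (g u) j) i +
    if i.isRight = true ∧ i = j then 1 / 2 else 0

/-- For a source at a new vertex, averaging columns injects `1 / 2` at each end of its edge. The
diagonal term `1 / 2` supplies the unit current at the new vertex, which has degree 2, and cancels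
those two halves. No current leaves at new vertices. -/
theorem IsGreenKernel.qTriangulation {G : SimpleGraph V} {g : V → V → ℝ} {κ : V → ℝ}
    (h : G.IsGreenKernel g κ) (q : ℕ) :
    (G.qTriangulation q).IsGreenKernel (qTriangulationKernel q G g) (Sum.elim κ 0) := by
  have hq : ((q : ℝ) + 2) ≠ 0 := by positivity
  refine ⟨?_, ?_, ?_⟩
  · intro i j
    unfold qTriangulationKernel
    rw [harmonicExtension_comm]
    simp only [h.symm]
    congr 1
    by_cases hij : i = j
    · subst hij
      rfl
    · simp [hij, Ne.symm hij]
  · intro x j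
    have e : ∀ y, qTriangulationKernel q G g x j - qTriangulationKernel q G g y j =
        2 / (q + 2) * (harmonicExtension q G (fun u => harmonicExtension q G (g u) j) x -
          harmonicExtension q G (fun u => harmonicExtension q G (g u) j) y) +
        ((if x.isRight = true ∧ x = j then 1 / 2 else 0) -
          if y.isRight = true ∧ y = j then 1 / 2 else 0) := by
      intro y
      unfold qTriangulationKernel
      ring
    simp only [e, Finset.sum_add_distrib, ← Finset.mul_sum]
    rcases x with x | p
    · rw [laplacian_harmonicExtension_inl]
      -- Extension in the second variable is linear and fixes constants, so it can be applied to the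
      -- Laplacian equation of `g` at `x`.
      have e2 : ∑ y ∈ G.neighborFinset x,
          (harmonicExtension q G (g x) j - harmonicExtension q G (g y) j) =
          harmonicExtension q G (fun i => if x = i then 1 else 0) j - κ x := by
        simp only [← harmonicExtension_sub, ← harmonicExtension_sum, h.laplacian]
        rw [harmonicExtension_sub, harmonicExtension_const]
      rw [e2, sum_neighborFinset_qTriangulation_inl]
      rcases j with j | ⟨f, b⟩
      · simp [harmonicExtension]
        field_simp
      · have e3 : ∀ e : G.edgeSet, (if x ∈ (e : Sym2 V) then -∑ a : Fin q,
            (if e = f ∧ a = b then (2⁻¹ : ℝ) else 0) else 0) =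
            if e = f then (if x ∈ (f : Sym2 V) then -2⁻¹ else 0) else 0 := by
          intro e
          by_cases hef : e = f
          · subst hef
            simp
          · simp [hef]
        simp only [harmonicExtension, edgeMean_single, Sum.isRight_inl, Bool.false_eq_true,
          if_false, zero_sub, sub_self, Finset.sum_const_zero, zero_add,
          Sum.isRight_inr, true_and, Sum.inr.injEq, Prod.mk.injEq, Finset.sum_neg_distrib,
          one_div, reduceCtorEq, and_false, Sum.elim_inl]
        rw [Finset.sum_congr rfl fun e _ => e3 e, Finset.sum_ite_eq', if_pos (Finset.mem_univ f)]
        field_simp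
        split_ifs <;> ring
    · rw [laplacian_harmonicExtension_inr, sum_neighborFinset_qTriangulation_inr]
      simp [edgeMean_const]
  · simp [Fintype.sum_sum_type, h.sum_eq_one]

end QTriangulation

/-! ### Recurrences for one triangulation step. -/

section Step

open scoped Classical

variable {V : Type u} [Fintype V]

/-- Each new vertex hands half its weight to either end of its edge, and `x` has `q * deg x` new
neighbours. -/
theorem sum_mul_harmonicExtension (q : ℕ) (G : SimpleGraph V) (α : V → ℝ) (ω : ℝ) (f : V → ℝ) :
    ∑ i, Sum.elim α (fun _ => ω) i * harmonicExtension q G f i =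
      ∑ x, (α x + ω * q / 2 * G.degree x) * f x := by
  simp only [Fintype.sum_sum_type, Fintype.sum_prod_type, harmonicExtension, Sum.elim_inl,
    Sum.elim_inr, Finset.sum_const, Finset.card_univ, Fintype.card_fin, nsmul_eq_mul,
    ← Finset.mul_sum, sum_edgeMean, add_mul, Finset.sum_add_distrib, mul_assoc]
  ring

theorem sum_mul_qTriangulationKernel (q : ℕ) (G : SimpleGraph V) (g : V → V → ℝ)
    (α β : V → ℝ) (ω ξ : ℝ) :
    ∑ i, Sum.elim α (fun _ => ω) i *
        ∑ j, Sum.elim β (fun _ => ξ) j * qTriangulationKernel q G g i j =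
      2 / (q + 2) * ∑ x, (α x + ω * q / 2 * G.degree x) *
        ∑ y, (β y + ξ * q / 2 * G.degree y) * g x y +
      ω * ξ / 2 * (q * ((∑ x, (G.degree x : ℝ)) / 2)) := by
  have h1 : ∀ i, ∑ j, Sum.elim β (fun _ => ξ) j * qTriangulationKernel q G g i j =
      2 / (q + 2) * harmonicExtension q G
        (fun x => ∑ y, (β y + ξ * q / 2 * G.degree y) * g x y) i +
      Sum.elim (fun _ => 0) (fun _ => ξ / 2) i := by
    intro i
    simp only [← sum_mul_harmonicExtension, harmonicExtension_sum, harmonicExtension_mul]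
    unfold qTriangulationKernel
    simp only [mul_add, Finset.sum_add_distrib, Finset.mul_sum]
    congr 1
    · exact Finset.sum_congr rfl fun j _ => by ring
    · rcases i with i | i <;> simp [div_eq_mul_inv]
  simp only [h1, mul_add, Finset.sum_add_distrib, mul_left_comm _ (2 / ((q : ℝ) + 2)),
    ← Finset.mul_sum, sum_mul_harmonicExtension]
  congr 1
  simp only [Fintype.sum_sum_type, Sum.elim_inl, Sum.elim_inr, mul_zero, Finset.sum_const_zero,
    zero_add, Finset.sum_const, Finset.card_univ, Fintype.card_prod, Fintype.card_fin,
    nsmul_eq_mul, Nat.cast_mul, card_edgeSet_eq]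
  ring

theorem IsGreenKernel.sum_mul_qTriangulationKernel_diag {G : SimpleGraph V} {g : V → V → ℝ}
    {κ : V → ℝ} (h : G.IsGreenKernel g κ) (q : ℕ) (α : V → ℝ) (ω : ℝ) :
    ∑ i, Sum.elim α (fun _ => ω) i * qTriangulationKernel q G g i i =
      2 / (q + 2) * ∑ x, α x * g x x + ω * q * (2 / (q + 2) / 4 *
        (2 * ∑ x, G.degree x * g x x - (Fintype.card V - 1)) + (∑ x, (G.degree x : ℝ)) / 4) := by
  have h1 := sum_edgeMean_edgeMean G g
  rw [Finset.sum_add_distrib, h.foster] at h1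
  simp only [Fintype.sum_sum_type, Fintype.sum_prod_type, harmonicExtension, Sum.elim_inl,
    Sum.elim_inr, Finset.sum_const, Finset.card_univ, Fintype.card_fin, nsmul_eq_mul,
    qTriangulationKernel, Sum.isRight_inl, Sum.isRight_inr, and_true, if_true, mul_add,
    Finset.sum_add_distrib, Bool.false_eq_true, if_false, mul_zero,
    Fintype.card_prod, Nat.cast_mul,
    ← Finset.mul_sum, mul_left_comm _ (2 / ((q : ℝ) + 2)), h1, card_edgeSet_eq]
  ring

theorem sum_elim_qTriangulation (q : ℕ) (G : SimpleGraph V) (α : V → ℝ) (ω : ℝ) :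
    ∑ i : V ⊕ (G.edgeSet × Fin q), Sum.elim α (fun _ => ω) i =
      ∑ x, α x + ω * (q * ((∑ x, (G.degree x : ℝ)) / 2)) := by
  simp only [Fintype.sum_sum_type, Sum.elim_inl, Sum.elim_inr, Finset.sum_const, Finset.card_univ,
    Fintype.card_prod, Fintype.card_fin, nsmul_eq_mul, Nat.cast_mul, card_edgeSet_eq]
  ring

theorem degree_qTriangulation (q : ℕ) (G : SimpleGraph V) (i : V ⊕ (G.edgeSet × Fin q)) :
    ((G.qTriangulation q).degree i : ℝ) =
      Sum.elim (fun x => (1 + q) * (G.degree x : ℝ)) (fun _ => 2) i := by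
  cases i
  · exact degree_qTriangulation_inl q G _
  · exact degree_qTriangulation_inr q G _

theorem card_qTriangulation (q : ℕ) (G : SimpleGraph V) :
    (Fintype.card (V ⊕ (G.edgeSet × Fin q)) : ℝ) =
      Fintype.card V + q * ((∑ x, (G.degree x : ℝ)) / 2) := by
  simp only [Fintype.card_sum, Fintype.card_prod, Fintype.card_fin, Nat.cast_add, Nat.cast_mul,
    card_edgeSet_eq]
  ring

theorem sum_degree_qTriangulation (q : ℕ) (G : SimpleGraph V) :
    ∑ i, ((G.qTriangulation q).degree i : ℝ) = (2 * q + 1) * ∑ x, (G.degree x : ℝ) := by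
  simp only [degree_qTriangulation, sum_elim_qTriangulation, ← Finset.mul_sum]
  ring

theorem IsGreenKernel.multiplicativeDegreeKirchhoff_qTriangulation {G : SimpleGraph V}
    {g : V → V → ℝ} {κ : V → ℝ} (h : G.IsGreenKernel g κ) (q : ℕ) {m : ℝ}
    (hm : ∑ x, (G.degree x : ℝ) = 2 * m) :
    (G.qTriangulation q).multiplicativeDegreeKirchhoff =
      2 / (q + 2) * (2 * q + 1) ^ 2 * G.multiplicativeDegreeKirchhoff
      + 2 * m * (2 * q + 1) * q * (m - 2 / (q + 2) * (Fintype.card V - 1) / 2) - 2 * m * q := by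
  rw [(h.qTriangulation q).multiplicativeDegreeKirchhoff_eq, h.multiplicativeDegreeKirchhoff_eq,
    sum_degree_qTriangulation]
  simp only [degree_qTriangulation]
  rw [h.sum_mul_qTriangulationKernel_diag, sum_mul_qTriangulationKernel]
  -- The pulled-back degree weight is again proportional to the degree, so the recurrence involves
  -- no other index.
  have e : ∀ x, (1 + (q : ℝ)) * G.degree x + 2 * q / 2 * G.degree x =
      (2 * q + 1) * G.degree x := by
    intro x
    ring
  simp only [e, hm, mul_assoc, mul_left_comm _ (2 * (q : ℝ) + 1), ← Finset.mul_sum]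
  ring

theorem IsGreenKernel.additiveDegreeKirchhoff_qTriangulation {G : SimpleGraph V}
    {g : V → V → ℝ} {κ : V → ℝ} (h : G.IsGreenKernel g κ) (q : ℕ) {m : ℝ}
    (hm : ∑ x, (G.degree x : ℝ) = 2 * m) :
    (G.qTriangulation q).additiveDegreeKirchhoff =
      2 / (q + 2) * (2 * q + 1) *
        (G.additiveDegreeKirchhoff + q * G.multiplicativeDegreeKirchhoff)
      + (Fintype.card V + m * q + m * (2 * q + 1)) * q *
        (m - 2 / (q + 2) * (Fintype.card V - 1) / 2) - 2 * m * q := by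
  rw [(h.qTriangulation q).additiveDegreeKirchhoff_eq, h.multiplicativeDegreeKirchhoff_eq,
    h.additiveDegreeKirchhoff_eq, sum_degree_qTriangulation, card_qTriangulation]
  simp only [degree_qTriangulation]
  have h1 : ∑ i, qTriangulationKernel q G g i i =
      ∑ i, Sum.elim (fun _ => 1) (fun _ => 1) i * qTriangulationKernel q G g i i := by
    refine Finset.sum_congr rfl fun i _ => ?_
    rcases i with i | i <;> simp
  have h2 : ∀ i, ∑ j, qTriangulationKernel q G g i j =
      ∑ j, Sum.elim (fun _ => 1) (fun _ => 1) j * qTriangulationKernel q G g i j := by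
    intro i
    refine Finset.sum_congr rfl fun j _ => ?_
    rcases j with j | j <;> simp
  simp only [h1, h2]
  rw [h.sum_mul_qTriangulationKernel_diag, h.sum_mul_qTriangulationKernel_diag,
    sum_mul_qTriangulationKernel]
  have e : ∀ x, (1 + (q : ℝ)) * G.degree x + 2 * q / 2 * G.degree x =
      (2 * q + 1) * G.degree x := by
    intro x
    ring
  -- The constant weight acquires a degree part, which brings in the multiplicative index.
  have e' : ∑ x, (2 * (q : ℝ) + 1) * G.degree x *
      ∑ y, (1 + 1 * (q : ℝ) / 2 * G.degree y) * g x y =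
      (2 * q + 1) * (∑ x, G.degree x * ∑ y, g x y +
        q / 2 * ∑ x, G.degree x * ∑ y, G.degree y * g x y) := by
    simp only [add_mul, one_mul, Finset.sum_add_distrib, mul_add, Finset.mul_sum, mul_assoc]
    simp only [mul_left_comm (G.degree _ : ℝ) ((q : ℝ) / 2)]
  simp only [e]
  rw [e']
  simp only [hm, one_mul, mul_assoc, mul_left_comm _ (2 * (q : ℝ) + 1), ← Finset.mul_sum]
  ring

end Step

/-! ### Solving the recurrences. -/

open scoped Classical in
-- The multiplicative recurrence has homogeneous rate `2(2q+1)²/(q+2)` and forcing terms in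
-- `(2q+1)^(2k)` and `(2q+1)^k`. A Green kernel is carried along in place of connectedness.
theorem iteratedQTriangulation_invariants {V : Type*} [Fintype V] (G : SimpleGraph V)
    (hG : G.Connected) (q : ℕ) (n m : ℝ) (hn : n = Fintype.card V)
    (hm : ∑ x, (G.degree x : ℝ) = 2 * m) (k : ℕ) :
    (∃ g κ, (G.iteratedQTriangulation q k).graph.IsGreenKernel g κ) ∧
    (Fintype.card (G.iteratedQTriangulation q k).V : ℝ) = n + m * ((2 * q + 1) ^ k - 1) / 2 ∧
    ∑ x, ((G.iteratedQTriangulation q k).graph.degree x : ℝ) = 2 * (m * (2 * q + 1) ^ k) ∧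
    (G.iteratedQTriangulation q k).graph.multiplicativeDegreeKirchhoff =
      (2 / (q + 2)) ^ k * ((2 * q + 1) ^ k) ^ 2 * G.multiplicativeDegreeKirchhoff
      + m ^ 2 * (2 * q + 3) / (2 * q + 1) *
        (((2 * q + 1) ^ k) ^ 2 - (2 / (q + 2)) ^ k * ((2 * q + 1) ^ k) ^ 2)
      + m * (2 * (2 * q + 1) * (n - 1 - m / 2) + 2 * (q + 2)) / (3 * (2 * q + 1)) *
        ((2 * q + 1) ^ k - (2 / (q + 2)) ^ k * ((2 * q + 1) ^ k) ^ 2) := by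
  induction k with
  | zero =>
    refine ⟨hG.exists_isGreenKernel, ?_, ?_, ?_⟩
    · change (Fintype.card V : ℝ) = _
      simp [hn]
    · change ∑ x, (G.degree x : ℝ) = _
      simpa using hm
    · change G.multiplicativeDegreeKirchhoff = _
      simp
  | succ k ih =>
    obtain ⟨⟨g, κ, hg⟩, hc, hd, hM⟩ := ih
    refine ⟨⟨_, _, hg.qTriangulation q⟩, ?_, ?_, ?_⟩
    · refine (card_qTriangulation q (G.iteratedQTriangulation q k).graph).trans ?_
      rw [hc, hd]
      ring
    · refine (sum_degree_qTriangulation q (G.iteratedQTriangulation q k).graph).trans ?_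
      rw [hd]
      ring
    · refine (hg.multiplicativeDegreeKirchhoff_qTriangulation q hd).trans ?_
      rw [hM, hc, pow_succ (2 * (q : ℝ) + 1) k, pow_succ (2 / ((q : ℝ) + 2)) k]
      generalize (2 * (q : ℝ) + 1) ^ k = P
      generalize (2 / ((q : ℝ) + 2)) ^ k = C
      have h1 : (2 * (q : ℝ) + 1) ≠ 0 := by positivity
      have h2 : ((q : ℝ) + 2) ≠ 0 := by positivity
      field_simp
      ring

end SimpleGraph

theorem theorem11 {V : Type*} [Fintype V] (G : SimpleGraph V) (hG : G.Connected)
    (q : ℕ) (hq : 1 ≤ q) (k : ℕ) (n m : ℕ)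
    (hn : n = Fintype.card V) (hm : m = G.edgeSet.ncard) :
    (G.iteratedQTriangulation q k).graph.additiveDegreeKirchhoff =
      ((2 * (2 * q + 1) : ℝ) / (q + 2)) ^ k * G.additiveDegreeKirchhoff
      + (((2 * (2 * q + 1) ^ 2 : ℝ) / (q + 2)) ^ k - ((2 * (2 * q + 1) : ℝ) / (q + 2)) ^ k)
        * (G.multiplicativeDegreeKirchhoff / 2
          - (2 * (q + 2) * (m : ℝ) ^ 2 + (2 * q + 1) * m * n - m * ((q : ℝ) - 1))
            / (3 * (2 * q + 1)))
      + ((2 * q + 1 : ℝ) ^ (2 * k) - ((2 * (2 * q + 1) : ℝ) / (q + 2)) ^ k)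
        * ((m : ℝ) ^ 2 * (2 * q + 3) * (6 * q + 11) / (4 * (2 * q + 1) * (2 * q + 5)))
      + (((2 * (2 * q + 1) : ℝ) / (q + 2)) ^ k - (2 * q + 1 : ℝ) ^ k)
        * ((m : ℝ) / (2 * (2 * q + 1))
          + (q + 2) * (m : ℝ) * ((m : ℝ) - 2 * n + 1) / (3 * (2 * q + 1)))
      - (((2 * (2 * q + 1) : ℝ) / (q + 2)) ^ k - 1)
        * (((m : ℝ) - 2 * n) * ((m : ℝ) - 2 * n + 2) / 12) := by
  classical
  have hd : ∑ x, (G.degree x : ℝ) = 2 * m := by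
    rw [hm, ← Nat.card_coe_set_eq, Nat.card_eq_fintype_card, G.card_edgeSet_eq]
    ring
  -- All powers are expressed through `(2q+1)^k` and `(2/(q+2))^k`, so that the induction step
  -- becomes a rational identity.
  have e1 : ∀ k : ℕ, ((2 * (2 * q + 1) : ℝ) / (q + 2)) ^ k =
      (2 / (q + 2)) ^ k * (2 * q + 1) ^ k := by
    intro k
    rw [← mul_pow]
    ring
  have e2 : ∀ k : ℕ, ((2 * (2 * q + 1) ^ 2 : ℝ) / (q + 2)) ^ k =
      (2 / (q + 2)) ^ k * ((2 * q + 1) ^ k) ^ 2 := by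
    intro k
    rw [pow_right_comm, ← mul_pow]
    ring
  simp only [e1, e2, pow_mul' _ 2]
  induction k with
  | zero =>
    change G.additiveDegreeKirchhoff = _
    simp
  | succ k ih =>
    obtain ⟨⟨g, κ, hg⟩, hc, hd, hM⟩ :=
      G.iteratedQTriangulation_invariants hG q n m (by rw [hn]) (by convert hd) k
    refine (hg.additiveDegreeKirchhoff_qTriangulation q hd).trans ?_
    rw [ih, hM, hc, pow_succ (2 * (q : ℝ) + 1) k, pow_succ (2 / ((q : ℝ) + 2)) k]
    generalize (2 * (q : ℝ) + 1) ^ k = P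
    generalize (2 / ((q : ℝ) + 2)) ^ k = C
    have h1 : (2 * (q : ℝ) + 1) ≠ 0 := by positivity
    have h2 : ((q : ℝ) + 2) ≠ 0 := by positivity
    -- This denominator comes from the gap between two rates: `(2q+1)² - 2(2q+1)/(q+2) =
    -- q(2q+1)(2q+5)/(q+2)`.
    have h3 : (2 * (q : ℝ) + 5) ≠ 0 := by positivity
    field_simp
    ring
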